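/- **Setting.** Let $m\ge 2$, $1\le k\le m-1$, let $M$ be an oriented, time-oriented $m$-dimensional Lorentzian manifold of signature $(m-1,1)$ with a compact, smoothly embedded Cauchy surface $\iota_\Sigma:\Sigma\hookrightarrow M$ (a closed achronal set with domain of dependence $M$), and let $[\Sigma]\in H_{m-1}(\Sigma;\mathbb Z)$ be the fundamental class of the oriented closed manifold $\Sigma$, $c=(\iota_\Sigma)_*[\Sigma]\in H_{m-1}(M;\mathbb Z)$. Write $H^p(M;\cdot)$ for smooth singular cohomology and $H^p_{\mathrm{free}}(M;\mathbb Z)$ for the quotient of $H^p(M;\mathbb Z)$ by its torsion subgroup, which maps to $H^p(M;\mathbb R)$; write $G^{p,q}=G^p\times G^q$ and $\mathbb T=\mathbb R/\mathbb Z$. For $p+q=m-1$ let $$\langle\cdot,\cdot\rangle:\ \frac{H^{p}(M;\mathbb R)}{H^{p}_{\mathrm{free}}(M;\mathbb Z)}\times H^{q}_{\mathrm{free}}(M;\mathbb Z)\to\mathbb T,\qquad \langle[\theta],y\rangle=(\theta\smile y)(c)\ \bmod\ \mathbb Z .$$ On the Abelian group $$G=\frac{H^{k-1,m-k-1}(M;\mathbb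 R)}{H^{k-1,m-k-1}_{\mathrm{free}}(M;\mathbb Z)}\times H^{k,m-k}_{\mathrm{free}}(M;\mathbb Z)\ni(u,\tilde u,v,\tilde v)$$ consider the pre-symplectic ($\mathbb T$-valued, biadditive, alternating) form, with $s=(-1)^{k(m-k)}$, $$\tau_{lr}\big((u,\tilde u,v,\tilde v),(u',\tilde u',v',\tilde v')\big)=\langle\tilde u,v'\rangle-s\langle u,\tilde v'\rangle-\langle\tilde u',v\rangle+s\langle u',\tilde v\rangle .$$ Let $\mathcal A_{lr}=\mathfrak{CCR}(G,\tau_{lr})$ be the $C^*$-algebra obtained from the $*$-algebra spanned by the symbols $\mathcal W(x)$, $x\in G$, with $\mathcal W(x)\mathcal W(y)=e^{2\pi i\tau_{lr}(x,y)}\mathcal W(x+y)$ and $\mathcal W(x)^*=\mathcal W(-x)$, by completion in the minimal regular norm $\|a\|=\sup_\omega\sqrt{\omega(a^*a)}$, where $\omega$ runs over all states. A state is a linear functional $\omega$ with $\omega(a^*a)\ge 0$ for all $a$ and $\omega(\mathbf 1)=1$; it is faithful if $\omega(a^*a)=0$ implies $a=0$. **Proposition.** There is exactly one continuous linear functional $\omega_t:\mathcal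 A_{lr}\to\mathbb C$ such that $$\omega_t\big(\mathcal W(u,\tilde u,v,\tilde v)\big)=\begin{cases}1,& v=0\text{ and }\tilde v=0,\\ 0,&\text{otherwise,}\end{cases}$$ and: 1. $\omega_t$ is a state on $\mathcal A_{lr}$. 2. If $H^{k-1,m-k-1}(M;\mathbb R)/H^{k-1,m-k-1}_{\mathrm{free}}(M;\mathbb Z)\neq 0$, then $\omega_t$ is not faithful. 3. The set $\{a\in\mathcal A_{lr}:\omega_t(a^*a)=0\}$ is a left ideal (the Gelfand ideal of $\omega_t$), and modulo this ideal $$\mathcal W(u,\tilde u,v,\tilde v)\ \sim\ e^{2\pi i\left(\langle\tilde u,v\rangle-(-1)^{k(m-k)}\langle u,\tilde v\rangle\right)}\,\mathcal W(0,0,v,\tilde v)\qquad\text{for all }(u,\tilde u,v,\tilde v)\in G .$$ -/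

import Mathlib

namespace TopSector

section Weyl

open scoped ComplexOrder

/-- A linear functional on a unital `*`-algebra is a state if it is positive and normalized. -/
def IsState {A : Type*} [Ring A] [StarRing A] [Module ℂ A] (ω : A →ₗ[ℂ] ℂ) : Prop :=
  (∀ a, 0 ≤ ω (star a * a)) ∧ ω 1 = 1

/-- A positive functional is faithful if `ω (a⋆ a)` vanishes for `a = 0` only. -/
def IsFaithful {A : Type*} [Ring A] [StarRing A] [Module ℂ A] (ω : A →ₗ[ℂ] ℂ) : Prop :=
  ∀ a, ω (star a * a) = 0 → a = 0

/-- `phase t = exp (2 π i t)` for `t ∈ 𝕋 = ℝ / ℤ`. -/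
noncomputable def phase (t : UnitAddCircle) : ℂ := (AddCircle.toCircle t : ℂ)

theorem phase_zero : phase 0 = 1 := by simp [phase]

theorem phase_add (s t : UnitAddCircle) : phase (s + t) = phase s * phase t := by
  simp [phase, AddCircle.toCircle_add]

theorem star_phase (t : UnitAddCircle) : star (phase t) = phase (-t) := by
  simp [phase, AddCircle.toCircle_neg, ← Circle.coe_inv_eq_conj]

theorem phase_coe (t : ℝ) : phase (t : UnitAddCircle) = Complex.exp (2 * Real.pi * Complex.I * t) := by
  simp [phase, AddCircle.toCircle_apply_mk, Circle.coe_exp]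
  ring_nf

/-- A pre-symplectic structure on an Abelian group: a biadditive alternating `𝕋`-valued form. -/
structure PreSymplectic (G : Type*) [AddCommGroup G] where
  form : G →+ G →+ UnitAddCircle
  alt : ∀ x, form x x = 0

variable {G : Type*} [AddCommGroup G]

theorem PreSymplectic.swap (τ : PreSymplectic G) (x y : G) : τ.form y x = -τ.form x y := by
  have h := τ.alt (x + y)
  simp only [map_add, AddMonoidHom.add_apply, τ.alt, zero_add, add_zero] at h
  exact eq_neg_of_add_eq_zero_left h

/-- The complex vector space spanned by abstract symbols `W x`, `x ∈ G`. -/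
def WeylAlg₀ (_τ : PreSymplectic G) : Type _ := G →₀ ℂ

namespace WeylAlg₀

variable {τ : PreSymplectic G}

noncomputable instance : AddCommGroup (WeylAlg₀ τ) := inferInstanceAs (AddCommGroup (G →₀ ℂ))
noncomputable instance : Module ℂ (WeylAlg₀ τ) := inferInstanceAs (Module ℂ (G →₀ ℂ))

/-- The Weyl symbol `W x`. -/
noncomputable def W (τ : PreSymplectic G) (x : G) : WeylAlg₀ τ := Finsupp.single x (1 : ℂ)

theorem induct {p : WeylAlg₀ τ → Prop} (a : WeylAlg₀ τ) (zero : p 0)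
    (add : ∀ a b, p a → p b → p (a + b)) (smul : ∀ (c : ℂ) x, p (c • W τ x)) : p a := by
  refine Finsupp.induction_linear (motive := p) a zero add fun x c => ?_
  have h : (Finsupp.single x c : G →₀ ℂ) = c • W τ x :=
    (Finsupp.smul_single_one x c).symm
  exact h ▸ smul c x

/-- The bilinear product determined by `W x * W y = exp (2 π i τ(x, y)) W (x + y)`. -/
noncomputable def mulLin (τ : PreSymplectic G) : WeylAlg₀ τ →ₗ[ℂ] WeylAlg₀ τ →ₗ[ℂ] WeylAlg₀ τ :=
  Finsupp.linearCombination ℂ fun x =>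
    (Finsupp.linearCombination ℂ fun y => phase (τ.form x y) • W τ (x + y) :
      (G →₀ ℂ) →ₗ[ℂ] WeylAlg₀ τ)

noncomputable instance : Mul (WeylAlg₀ τ) := ⟨fun a b => mulLin τ a b⟩
noncomputable instance : One (WeylAlg₀ τ) := ⟨W τ 0⟩

theorem one_def : (1 : WeylAlg₀ τ) = W τ 0 := rfl

theorem mul_def (a b : WeylAlg₀ τ) : a * b = mulLin τ a b := rfl

theorem W_mul_W (x y : G) : W τ x * W τ y = phase (τ.form x y) • W τ (x + y) := by
  rw [mul_def, mulLin]
  unfold W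
  erw [Finsupp.linearCombination_single, one_smul, Finsupp.linearCombination_single, one_smul]

theorem smul_mul' (c : ℂ) (a b : WeylAlg₀ τ) : c • a * b = c • (a * b) := by
  simp [mul_def]

theorem mul_smul' (c : ℂ) (a b : WeylAlg₀ τ) : a * c • b = c • (a * b) := by
  simp [mul_def]

theorem add_mul' (a b c : WeylAlg₀ τ) : (a + b) * c = a * c + b * c := by
  simp [mul_def]

theorem mul_add' (a b c : WeylAlg₀ τ) : a * (b + c) = a * b + a * c := by
  simp [mul_def]

theorem zero_mul' (a : WeylAlg₀ τ) : 0 * a = 0 := by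
  simp [mul_def]

theorem mul_zero' (a : WeylAlg₀ τ) : a * 0 = 0 := by
  simp [mul_def]

theorem mul_assoc' (a b c : WeylAlg₀ τ) : a * b * c = a * (b * c) := by
  induction a using induct with
  | zero => simp only [zero_mul']
  | add a a' h h' => simp only [add_mul', h, h']
  | smul r x =>
    induction b using induct with
    | zero => simp only [zero_mul', mul_zero']
    | add a a' h h' => simp only [add_mul', mul_add', h, h']
    | smul s y =>
      induction c using induct with
      | zero => simp only [mul_zero']
      | add a a' h h' => simp only [mul_add', h, h']
      | smul t z =>
        simp only [smul_mul', mul_smul', W_mul_W, smul_smul, add_assoc, map_add,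
          AddMonoidHom.add_apply, phase_add]
        congr 1
        ring

noncomputable instance : Ring (WeylAlg₀ τ) :=
  { (inferInstance : AddCommGroup (WeylAlg₀ τ)),
    (inferInstance : Mul (WeylAlg₀ τ)),
    (inferInstance : One (WeylAlg₀ τ)) with
    left_distrib := mul_add'
    right_distrib := add_mul'
    zero_mul := zero_mul'
    mul_zero := mul_zero'
    mul_assoc := mul_assoc'
    one_mul := fun a => by
      induction a using induct with
      | zero => exact mul_zero' _
      | add a b h h' => rw [mul_add', h, h']
      | smul c x => rw [one_def, mul_smul', W_mul_W]; simp [phase_zero]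
    mul_one := fun a => by
      induction a using induct with
      | zero => exact zero_mul' _
      | add a b h h' => rw [add_mul', h, h']
      | smul c x => rw [one_def, smul_mul', W_mul_W]; simp [phase_zero] }

noncomputable instance : Algebra ℂ (WeylAlg₀ τ) := Algebra.ofModule smul_mul' mul_smul'

/-- The antilinear involution determined by `(W x)⋆ = W (-x)`. -/
noncomputable def starHom (τ : PreSymplectic G) : WeylAlg₀ τ →+ WeylAlg₀ τ :=
  Finsupp.liftAddHom fun x =>
    ((AddMonoidHom.flip (smulAddHom ℂ (WeylAlg₀ τ))) (W τ (-x))).comp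
      (starAddEquiv : ℂ ≃+ ℂ).toAddMonoidHom

theorem starHom_smul_W (c : ℂ) (x : G) : starHom τ (c • W τ x) = star c • W τ (-x) := by
  have : c • W τ x = (Finsupp.single x c : G →₀ ℂ) := Finsupp.smul_single_one x c
  rw [this, starHom]
  erw [Finsupp.liftAddHom_apply_single]
  rfl

noncomputable instance : StarRing (WeylAlg₀ τ) where
  star := starHom τ
  star_involutive a := by
    induction a using induct with
    | zero => simp
    | add a b h h' => rw [map_add, map_add, h, h']
    | smul c x => rw [starHom_smul_W, starHom_smul_W]; simp
  star_add := map_add _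
  star_mul a b := by
    change starHom τ (a * b) = starHom τ b * starHom τ a
    induction a using induct with
    | zero => simp
    | add a a' h h' => rw [add_mul, map_add, map_add, mul_add, h, h']
    | smul r x =>
      induction b using induct with
      | zero => simp
      | add a a' h h' => rw [mul_add, map_add, map_add, add_mul, h, h']
      | smul s y =>
        simp only [smul_mul', mul_smul', W_mul_W, smul_smul, starHom_smul_W, star_mul', star_phase]
        rw [← τ.swap, add_comm x y, neg_add]
        simp only [map_neg, AddMonoidHom.neg_apply, neg_neg]
        congr 1
        ring

theorem star_smul_W (c : ℂ) (x : G) : star (c • W τ x) = star c • W τ (-x) := starHom_smul_W c x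

theorem star_W (x : G) : star (W τ x) = W τ (-x) := by
  simpa using star_smul_W (τ := τ) 1 x

instance : StarModule ℂ (WeylAlg₀ τ) where
  star_smul c a := by
    induction a using induct with
    | zero => simp
    | add a b h h' => simp only [smul_add, star_add, h, h']
    | smul r x => simp only [smul_smul, star_smul_W, star_mul']

theorem star_W_mul_W (x : G) : star (W τ x) * W τ x = 1 := by
  rw [star_W, W_mul_W, map_neg, AddMonoidHom.neg_apply, τ.alt, neg_add_cancel, one_def]
  simp [phase_zero]

/-- The semi-inner product `(a, b) ↦ ω (a⋆ b)` of a state. -/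
@[reducible]
noncomputable def core {ω : WeylAlg₀ τ →ₗ[ℂ] ℂ} (hω : IsState ω) :
    PreInnerProductSpace.Core ℂ (WeylAlg₀ τ) where
  inner a b := ω (star a * b)
  re_inner_nonneg a := (Complex.le_def.1 (hω.1 a)).1
  add_left a b c := by simp [add_mul]
  smul_left a b c := by simp
  conj_inner_symm a b := by
    have key (c : WeylAlg₀ τ) : (ω (star c * c)).im = 0 := (Complex.le_def.1 (hω.1 c)).2.symm
    have h1 := key (a + b)
    have h2 := key (a + Complex.I • b)
    simp [add_mul, mul_add, key] at h1 h2
    apply Complex.ext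
    · simp; linarith
    · simp; linarith

/-- `√(ω (a⋆ a))` -/
noncomputable def stateSeminorm (ω : WeylAlg₀ τ →ₗ[ℂ] ℂ) (a : WeylAlg₀ τ) : ℝ :=
  √ (ω (star a * a)).re

/-- The minimal regular norm `‖a‖ = sup_ω √(ω (a⋆ a))`, the supremum being over all states. -/
noncomputable def minRegNorm (a : WeylAlg₀ τ) : ℝ :=
  ⨆ ω : {ω : WeylAlg₀ τ →ₗ[ℂ] ℂ // IsState ω}, stateSeminorm ω.1 a

theorem cauchy_schwarz {ω : WeylAlg₀ τ →ₗ[ℂ] ℂ} (hω : IsState ω) (a b : WeylAlg₀ τ) :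
    ‖ω (star a * b)‖ ≤ stateSeminorm ω a * stateSeminorm ω b :=
  @InnerProductSpace.Core.norm_inner_le_norm ℂ _ _ _ _ (core hω) a b

theorem stateSeminorm_sq {ω : WeylAlg₀ τ →ₗ[ℂ] ℂ} (hω : IsState ω) (a : WeylAlg₀ τ) :
    stateSeminorm ω a ^ 2 = (ω (star a * a)).re :=
  Real.sq_sqrt (Complex.le_def.1 (hω.1 a)).1

theorem ofReal_stateSeminorm_sq {ω : WeylAlg₀ τ →ₗ[ℂ] ℂ} (hω : IsState ω) (a : WeylAlg₀ τ) :
    ((stateSeminorm ω a ^ 2 : ℝ) : ℂ) = ω (star a * a) := by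
  rw [stateSeminorm_sq hω]
  exact Complex.ext rfl (Complex.le_def.1 (hω.1 a)).2

theorem stateSeminorm_nonneg (ω : WeylAlg₀ τ →ₗ[ℂ] ℂ) (a : WeylAlg₀ τ) : 0 ≤ stateSeminorm ω a :=
  Real.sqrt_nonneg _

theorem stateSeminorm_add {ω : WeylAlg₀ τ →ₗ[ℂ] ℂ} (hω : IsState ω) (a b : WeylAlg₀ τ) :
    stateSeminorm ω (a + b) ≤ stateSeminorm ω a + stateSeminorm ω b :=
  @norm_add_le _ (@InnerProductSpace.Core.toSeminormedAddCommGroup ℂ _ _ _ _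
    (core hω)).toSeminormedAddGroup a b

theorem stateSeminorm_smul (ω : WeylAlg₀ τ →ₗ[ℂ] ℂ) (c : ℂ) (a : WeylAlg₀ τ) :
    stateSeminorm ω (c • a) = ‖c‖ * stateSeminorm ω a := by
  have h : star (c • a) * c • a = ((‖c‖ ^ 2 : ℝ) : ℂ) • (star a * a) := by
    rw [star_smul, smul_mul', mul_smul', smul_smul]
    congr 1
    simpa using Complex.conj_mul' c
  rw [stateSeminorm, h, map_smul, smul_eq_mul, Complex.re_ofReal_mul, Real.sqrt_mul (by positivity),
    Real.sqrt_sq (norm_nonneg c), stateSeminorm]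

theorem stateSeminorm_W {ω : WeylAlg₀ τ →ₗ[ℂ] ℂ} (hω : IsState ω) (x : G) :
    stateSeminorm ω (W τ x) = 1 := by
  simp [stateSeminorm, star_W_mul_W, hω.2]

theorem stateSeminorm_one {ω : WeylAlg₀ τ →ₗ[ℂ] ℂ} (hω : IsState ω) :
    stateSeminorm ω 1 = 1 := stateSeminorm_W hω 0

theorem exists_bound (a : WeylAlg₀ τ) :
    ∃ C, ∀ ω : {ω : WeylAlg₀ τ →ₗ[ℂ] ℂ // IsState ω}, stateSeminorm ω.1 a ≤ C := by
  induction a using induct with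
  | zero => exact ⟨0, fun ω => by simp [stateSeminorm]⟩
  | add a b h h' =>
    obtain ⟨C, hC⟩ := h
    obtain ⟨D, hD⟩ := h'
    exact ⟨C + D, fun ω => (stateSeminorm_add ω.2 a b).trans (add_le_add (hC ω) (hD ω))⟩
  | smul c x => exact ⟨‖c‖, fun ω => by rw [stateSeminorm_smul, stateSeminorm_W ω.2, mul_one]⟩

theorem stateSeminorm_le {ω : WeylAlg₀ τ →ₗ[ℂ] ℂ} (hω : IsState ω) (a : WeylAlg₀ τ) :
    stateSeminorm ω a ≤ minRegNorm a := by
  obtain ⟨C, hC⟩ := exists_bound a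
  exact le_ciSup (f := fun ω : {ω : WeylAlg₀ τ →ₗ[ℂ] ℂ // IsState ω} => stateSeminorm ω.1 a)
    ⟨C, by rintro _ ⟨ω, rfl⟩; exact hC ω⟩ ⟨ω, hω⟩

theorem minRegNorm_nonneg (a : WeylAlg₀ τ) : 0 ≤ minRegNorm a :=
  Real.iSup_nonneg fun ω => stateSeminorm_nonneg ω.1 a

theorem minRegNorm_le {a : WeylAlg₀ τ} {C : ℝ} (hC : 0 ≤ C)
    (h : ∀ ω : WeylAlg₀ τ →ₗ[ℂ] ℂ, IsState ω → stateSeminorm ω a ≤ C) : minRegNorm a ≤ C :=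
  Real.iSup_le (fun ω => h ω.1 ω.2) hC

theorem minRegNorm_smul (c : ℂ) (a : WeylAlg₀ τ) : minRegNorm (c • a) = ‖c‖ * minRegNorm a := by
  simp only [minRegNorm, stateSeminorm_smul]
  exact (Real.mul_iSup_of_nonneg (norm_nonneg c) _).symm

theorem stateSeminorm_mul {ω : WeylAlg₀ τ →ₗ[ℂ] ℂ} (hω : IsState ω) (a b : WeylAlg₀ τ) :
    stateSeminorm ω (a * b) ≤ minRegNorm a * stateSeminorm ω b := by
  have e : star (a * b) * (a * b) = star b * (star a * a * b) := by
    rw [star_mul]; simp only [mul_assoc]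
  rcases (stateSeminorm_nonneg ω b).eq_or_lt with h0 | hpos
  · have h := cauchy_schwarz hω b (star a * a * b)
    rw [← h0, zero_mul, ← e, ← ofReal_stateSeminorm_sq hω, Complex.norm_real] at h
    have h2 : stateSeminorm ω (a * b) = 0 := by
      have := norm_eq_zero.1 (le_antisymm h (norm_nonneg _))
      exact pow_eq_zero_iff (two_ne_zero) |>.1 this
    rw [h2, ← h0, mul_zero]
  · set r : ℝ := stateSeminorm ω b ^ 2 with hr
    have hr0 : 0 < r := by positivity
    let ν : WeylAlg₀ τ →ₗ[ℂ] ℂ :=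
      ((r⁻¹ : ℝ) : ℂ) • (ω ∘ₗ LinearMap.mulLeft ℂ (star b) ∘ₗ LinearMap.mulRight ℂ b)
    have hνa (c : WeylAlg₀ τ) : ν c = ((r⁻¹ : ℝ) : ℂ) * ω (star b * (c * b)) := rfl
    have hν : IsState ν := by
      constructor
      · intro c
        have e' : star b * (star c * c * b) = star (c * b) * (c * b) := by
          rw [star_mul]; simp only [mul_assoc]
        rw [hνa, e', ← ofReal_stateSeminorm_sq hω, ← Complex.ofReal_mul]
        exact Complex.zero_le_real.2 (by positivity)
      · rw [hνa, one_mul, ← ofReal_stateSeminorm_sq hω, ← hr, ← Complex.ofReal_mul,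
          inv_mul_cancel₀ hr0.ne', Complex.ofReal_one]
    have h1 : stateSeminorm ν a ^ 2 = r⁻¹ * stateSeminorm ω (a * b) ^ 2 := by
      rw [stateSeminorm_sq hν, hνa, ← e, ← ofReal_stateSeminorm_sq hω, ← Complex.ofReal_mul,
        Complex.ofReal_re]
    have h2 : stateSeminorm ω (a * b) ^ 2 = (stateSeminorm ν a * stateSeminorm ω b) ^ 2 := by
      rw [mul_pow, h1, ← hr]
      field_simp
    rw [(sq_eq_sq₀ (stateSeminorm_nonneg _ _)
      (mul_nonneg (stateSeminorm_nonneg _ _) (stateSeminorm_nonneg _ _))).1 h2]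
    exact mul_le_mul_of_nonneg_right (stateSeminorm_le hν a) hpos.le

theorem minRegNorm_mul (a b : WeylAlg₀ τ) : minRegNorm (a * b) ≤ minRegNorm a * minRegNorm b :=
  minRegNorm_le (mul_nonneg (minRegNorm_nonneg a) (minRegNorm_nonneg b)) fun _ hω =>
    (stateSeminorm_mul hω a b).trans
      (mul_le_mul_of_nonneg_left (stateSeminorm_le hω b) (minRegNorm_nonneg a))

theorem minRegNorm_mul_self_le (a : WeylAlg₀ τ) :
    minRegNorm a * minRegNorm a ≤ minRegNorm (star a * a) := by
  have h : minRegNorm a ≤ √ (minRegNorm (star a * a)) := by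
    refine minRegNorm_le (Real.sqrt_nonneg _) fun ω hω => Real.sqrt_le_sqrt ?_
    have := cauchy_schwarz hω 1 (star a * a)
    rw [star_one, one_mul, stateSeminorm_one hω, one_mul] at this
    exact (Complex.re_le_norm _).trans (this.trans (stateSeminorm_le hω _))
  calc minRegNorm a * minRegNorm a ≤ √ (minRegNorm (star a * a)) * √ (minRegNorm (star a * a)) :=
        mul_self_le_mul_self (minRegNorm_nonneg a) h
    _ = _ := Real.mul_self_sqrt (minRegNorm_nonneg _)

theorem minRegNorm_le_star (a : WeylAlg₀ τ) : minRegNorm a ≤ minRegNorm (star a) := by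
  rcases (minRegNorm_nonneg a).eq_or_lt with h0 | hpos
  · rw [← h0]; exact minRegNorm_nonneg _
  · exact le_of_mul_le_mul_right ((minRegNorm_mul_self_le a).trans (minRegNorm_mul _ _)) hpos

theorem minRegNorm_star (a : WeylAlg₀ τ) : minRegNorm (star a) = minRegNorm a :=
  le_antisymm (by simpa using minRegNorm_le_star (star a)) (minRegNorm_le_star a)

noncomputable instance : SeminormedAddCommGroup (WeylAlg₀ τ) :=
  AddGroupSeminorm.toSeminormedAddCommGroup
    { toFun := minRegNorm
      map_zero' := by simpa using minRegNorm_smul (0 : ℂ) (0 : WeylAlg₀ τ)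
      add_le' := fun a b => minRegNorm_le (add_nonneg (minRegNorm_nonneg a) (minRegNorm_nonneg b))
        fun _ hω => (stateSeminorm_add hω a b).trans
          (add_le_add (stateSeminorm_le hω a) (stateSeminorm_le hω b))
      neg' := fun a => by simpa using minRegNorm_smul (-1 : ℂ) a }

theorem norm_def (a : WeylAlg₀ τ) : ‖a‖ = minRegNorm a := rfl

noncomputable instance : SeminormedRing (WeylAlg₀ τ) :=
  { (inferInstance : Ring (WeylAlg₀ τ)),
    (inferInstance : SeminormedAddCommGroup (WeylAlg₀ τ)) with
    norm_mul_le := minRegNorm_mul }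

noncomputable instance : NormedAlgebra ℂ (WeylAlg₀ τ) where
  norm_smul_le c a := (minRegNorm_smul c a).le

instance : NormedStarGroup (WeylAlg₀ τ) := ⟨fun a => (minRegNorm_star a).le⟩

end WeylAlg₀

/-- The `C⋆`-algebra `CCR(G, τ)`: the completion of the Weyl `*`-algebra in the minimal regular
norm. -/
def CCR (τ : PreSymplectic G) : Type _ := UniformSpace.Completion (WeylAlg₀ τ)

namespace CCR

open UniformSpace

variable {τ : PreSymplectic G}

noncomputable instance : NormedRing (CCR τ) :=
  inferInstanceAs (NormedRing (Completion (WeylAlg₀ τ)))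

noncomputable instance : NormedAlgebra ℂ (CCR τ) :=
  { (inferInstance : Algebra ℂ (Completion (WeylAlg₀ τ))) with
    norm_smul_le := fun c a => norm_smul_le c (show Completion (WeylAlg₀ τ) from a) }

instance : CompleteSpace (CCR τ) :=
  inferInstanceAs (CompleteSpace (Completion (WeylAlg₀ τ)))

/-- The canonical map of the Weyl `*`-algebra into its completion. -/
noncomputable def of (a : WeylAlg₀ τ) : CCR τ := (a : Completion (WeylAlg₀ τ))

theorem of_add (a b : WeylAlg₀ τ) : of (a + b) = of a + of b := Completion.coe_add a b
theorem of_mul (a b : WeylAlg₀ τ) : of (a * b) = of a * of b := Completion.coe_mul a b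
theorem of_smul (c : ℂ) (a : WeylAlg₀ τ) : of (c • a) = c • of a := Completion.coe_smul c a
theorem of_one : of (1 : WeylAlg₀ τ) = 1 := rfl
theorem norm_of (a : WeylAlg₀ τ) : ‖of a‖ = WeylAlg₀.minRegNorm a := Completion.norm_coe a
theorem continuous_of : Continuous (of : WeylAlg₀ τ → CCR τ) := Completion.continuous_coe _

theorem induct {p : CCR τ → Prop} (a : CCR τ) (hp : IsClosed {a | p a}) (h : ∀ a, p (of a)) : p a :=
  Completion.induction_on a hp h

/-- The Weyl generator `W x` in `CCR(G, τ)`. -/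
noncomputable def W (τ : PreSymplectic G) (x : G) : CCR τ := of (WeylAlg₀.W τ x)

noncomputable def starMap (τ : PreSymplectic G) : CCR τ → CCR τ :=
  Completion.map (star : WeylAlg₀ τ → WeylAlg₀ τ)

theorem uniformContinuous_star : UniformContinuous (star : WeylAlg₀ τ → WeylAlg₀ τ) :=
  uniformContinuous_addMonoidHom_of_continuous
    (f := (starAddEquiv : WeylAlg₀ τ ≃+ WeylAlg₀ τ).toAddMonoidHom) continuous_star

theorem continuous_starMap : Continuous (starMap τ) := Completion.continuous_map

theorem starMap_of (a : WeylAlg₀ τ) : starMap τ (of a) = of (star a) :=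
  Completion.map_coe uniformContinuous_star a

/-- The involution of `CCR(G, τ)` is the continuous extension of that of the Weyl algebra. -/
noncomputable instance : StarRing (CCR τ) where
  star := starMap τ
  star_involutive a := by
    refine induct (p := fun a => starMap τ (starMap τ a) = a) a ?_ fun a => ?_
    · exact isClosed_eq (continuous_starMap.comp continuous_starMap) continuous_id
    · rw [starMap_of, starMap_of, star_star]
  star_add a b := by
    change starMap τ (a + b) = starMap τ a + starMap τ b
    refine Completion.induction_on₂ a b ?_ fun a b => ?_
    · exact isClosed_eq (continuous_starMap.comp (continuous_fst.add continuous_snd))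
        ((continuous_starMap.comp continuous_fst).add (continuous_starMap.comp continuous_snd))
    · change starMap τ (of a + of b) = starMap τ (of a) + starMap τ (of b)
      rw [← of_add, starMap_of, starMap_of, starMap_of, star_add, of_add]
  star_mul a b := by
    change starMap τ (a * b) = starMap τ b * starMap τ a
    refine Completion.induction_on₂ a b ?_ fun a b => ?_
    · exact isClosed_eq
        (continuous_starMap.comp ((continuous_fst : Continuous (Prod.fst : CCR τ × CCR τ → _)).mul
          continuous_snd))
        ((continuous_starMap.comp continuous_snd).mul
          ((continuous_starMap.comp continuous_fst) : Continuous (fun z : CCR τ × CCR τ => _)))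
    · change starMap τ (of a * of b) = starMap τ (of b) * starMap τ (of a)
      rw [← of_mul, starMap_of, starMap_of, starMap_of, star_mul, of_mul]

theorem star_of (a : WeylAlg₀ τ) : star (of a) = of (star a) := starMap_of a

theorem continuous_star' : Continuous (star : CCR τ → CCR τ) := continuous_starMap

instance : StarModule ℂ (CCR τ) where
  star_smul c a := by
    refine induct (p := fun a => star (c • a) = star c • star a) a ?_ fun a => ?_
    · exact isClosed_eq (continuous_star'.comp (continuous_const_smul c))
        (continuous_star'.const_smul (star c))
    · rw [← of_smul, star_of, star_of, star_smul, of_smul]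

instance : CStarRing (CCR τ) where
  norm_mul_self_le a := by
    refine induct (p := fun a => ‖a‖ * ‖a‖ ≤ ‖star a * a‖) a ?_ fun a => ?_
    · exact isClosed_le (continuous_norm.mul continuous_norm)
        ((continuous_star'.mul continuous_id).norm)
    · rw [star_of, ← of_mul, norm_of, norm_of]
      exact WeylAlg₀.minRegNorm_mul_self_le a

noncomputable instance : CStarAlgebra (CCR τ) where

end CCR

end Weyl

end TopSector

open scoped Manifold ContDiff

namespace TopSector

section Chains

variable {d : ℕ} {M : Type*} [TopologicalSpace M] [ChartedSpace (EuclideanSpace ℝ (Fin d)) M]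

variable (d M) in
/-- Smooth singular `n`-simplices of a smooth `d`-manifold: maps from the standard simplex
`Δⁿ ⊆ ℝⁿ⁺¹` that are smooth on `Δⁿ`. -/
def SmoothSimplex (n : ℕ) : Type _ :=
  {σ : stdSimplex ℝ (Fin (n + 1)) → M // ∃ f : (Fin (n + 1) → ℝ) → M,
    ContMDiffOn 𝓘(ℝ, Fin (n + 1) → ℝ) (𝓡 d) ∞ f (stdSimplex ℝ (Fin (n + 1))) ∧
      ∀ x : stdSimplex ℝ (Fin (n + 1)), f x = σ x}

/-- Precomposition of a simplex with the affine map given on vertices by `α`. -/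
noncomputable def SmoothSimplex.comp {n p : ℕ} (σ : SmoothSimplex d M n)
    (α : Fin (p + 1) → Fin (n + 1)) : SmoothSimplex d M p :=
  ⟨fun x => σ.1 (stdSimplex.map α x), by
    obtain ⟨f, hf, hfσ⟩ := σ.2
    refine ⟨fun x => f (FunOnFinite.linearMap ℝ ℝ α x), ?_, fun x => hfσ (stdSimplex.map α x)⟩
    refine hf.comp (t := stdSimplex ℝ (Fin (n + 1))) ?_
      fun x hx => (stdSimplex.map α ⟨x, hx⟩).2
    exact ((FunOnFinite.linearMap ℝ ℝ α).toContinuousLinearMap.contDiff.contMDiff).contMDiffOn⟩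

theorem SmoothSimplex.comp_comp {n p q : ℕ} (σ : SmoothSimplex d M n)
    (α : Fin (p + 1) → Fin (n + 1)) (β : Fin (q + 1) → Fin (p + 1)) :
    (σ.comp α).comp β = σ.comp (α ∘ β) :=
  Subtype.ext <| funext fun x => congrArg σ.1 (stdSimplex.map_comp_apply β α x)

variable (d M) in
/-- Smooth singular chains `C_n(M; ℤ)`. -/
abbrev Chain (n : ℕ) : Type _ := SmoothSimplex d M n →₀ ℤ

/-- A simplex, as a chain. -/
noncomputable def SmoothSimplex.chain {n : ℕ} (σ : SmoothSimplex d M n) : Chain d M n :=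
  Finsupp.single σ 1

/-- The homomorphism on chains with prescribed values on simplices. -/
noncomputable def liftChain {n : ℕ} {A : Type*} [AddCommGroup A] (f : SmoothSimplex d M n → A) :
    Chain d M n →+ A :=
  Finsupp.liftAddHom fun σ => (zmultiplesHom A) (f σ)

theorem liftChain_chain {n : ℕ} {A : Type*} [AddCommGroup A] (f : SmoothSimplex d M n → A)
    (σ : SmoothSimplex d M n) : liftChain f σ.chain = f σ := by
  simp [liftChain, SmoothSimplex.chain]

theorem chain_hom_ext {n : ℕ} {A : Type*} [AddCommGroup A] {f g : Chain d M n →+ A}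
    (h : ∀ σ : SmoothSimplex d M n, f σ.chain = g σ.chain) : f = g := by
  refine Finsupp.addHom_ext' fun σ => AddMonoidHom.ext_int ?_
  exact h σ

variable (d M) in
/-- The boundary `∂ σ = ∑ (-1)^i σ ∘ dⁱ`, where `dⁱ` is the inclusion of the `i`-th face. -/
noncomputable def bdry (n : ℕ) : Chain d M (n + 1) →+ Chain d M n :=
  liftChain fun σ => ∑ i : Fin (n + 2), (-1 : ℤ) ^ (i : ℕ) • (σ.comp i.succAbove).chain

variable (d M) in
/-- Cycles; every `0`-chain is a cycle. -/
noncomputable def cycles : (n : ℕ) → AddSubgroup (Chain d M n)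
  | 0 => ⊤
  | n + 1 => (bdry d M n).ker

variable (d M) in
/-- Smooth singular homology `H_n(M; ℤ)`. -/
abbrev Homology (n : ℕ) : Type _ :=
  cycles d M n ⧸ (bdry d M n).range.addSubgroupOf (cycles d M n)

/-- The chains of `M` lying in `S ⊆ M`. -/
noncomputable def chainsIn (S : Set M) (n : ℕ) : AddSubgroup (Chain d M n) :=
  AddSubgroup.closure {c | ∃ σ : SmoothSimplex d M n, Set.range σ.1 ⊆ S ∧ c = σ.chain}

/-- Chains representing cycles of `C_*(M) / C_*(S)`. -/
noncomputable def relCycles (S : Set M) : (n : ℕ) → AddSubgroup (Chain d M n)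
  | 0 => ⊤
  | n + 1 => (chainsIn S n).comap (bdry d M n)

variable (d) in
/-- Relative homology `H_n(M, S; ℤ)`: relative cycles modulo boundaries and chains in `S`. -/
abbrev RelHomology (S : Set M) (n : ℕ) : Type _ :=
  relCycles (d := d) S n ⧸ ((bdry d M n).range ⊔ chainsIn S n).addSubgroupOf (relCycles S n)

theorem cycles_le_relCycles (S : Set M) (n : ℕ) : cycles d M n ≤ relCycles S n := by
  cases n with
  | zero => exact le_rfl
  | succ n =>
      intro c hc
      change bdry d M n c ∈ chainsIn S n
      rw [AddMonoidHom.mem_ker.1 hc]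
      exact zero_mem _

/-- The canonical map `H_n(M; ℤ) → H_n(M, S; ℤ)`. -/
noncomputable def toRelHomology (S : Set M) (n : ℕ) : Homology d M n →+ RelHomology d S n :=
  QuotientAddGroup.map _ _ (AddSubgroup.inclusion (cycles_le_relCycles S n))
    fun _ hc => (le_sup_left : (bdry d M n).range ≤ _) hc

variable (d M) in
/-- A fundamental class of a closed `d`-manifold: a class of degree `d` whose image in
`H_d(M, M ∖ {x}; ℤ)` is a generator for all `x`. Choosing it is the same as orienting `M`. -/
structure FundamentalClass where
  cls : Homology d M d
  generates : ∀ x : M, ∀ y : RelHomology d ({x}ᶜ : Set M) d, ∃ a : ℤ,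
    y = a • toRelHomology ({x}ᶜ : Set M) d cls

end Chains

section Pushforward

variable {d e : ℕ} {M N : Type*} [TopologicalSpace M] [ChartedSpace (EuclideanSpace ℝ (Fin d)) M]
  [TopologicalSpace N] [ChartedSpace (EuclideanSpace ℝ (Fin e)) N]

/-- Composition of a smooth simplex with a smooth map. -/
def SmoothSimplex.push {n : ℕ} (f : N → M) (hf : ContMDiff (𝓡 e) (𝓡 d) ∞ f)
    (σ : SmoothSimplex e N n) : SmoothSimplex d M n :=
  ⟨f ∘ σ.1, by
    obtain ⟨g, hg, hgσ⟩ := σ.2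
    exact ⟨f ∘ g, hf.comp_contMDiffOn hg, fun x => congrArg f (hgσ x)⟩⟩

/-- The push-forward of chains. -/
noncomputable def pushChain (f : N → M) (hf : ContMDiff (𝓡 e) (𝓡 d) ∞ f) (n : ℕ) :
    Chain e N n →+ Chain d M n :=
  liftChain fun σ => (σ.push f hf).chain

theorem bdry_pushChain (f : N → M) (hf : ContMDiff (𝓡 e) (𝓡 d) ∞ f) (n : ℕ)
    (c : Chain e N (n + 1)) :
    bdry d M n (pushChain f hf (n + 1) c) = pushChain f hf n (bdry e N n c) := by
  suffices h : (bdry d M n).comp (pushChain f hf (n + 1)) =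
      (pushChain f hf n).comp (bdry e N n) from DFunLike.congr_fun h c
  refine chain_hom_ext fun σ => ?_
  simp only [AddMonoidHom.comp_apply, pushChain, bdry, liftChain_chain, map_sum, map_zsmul]
  rfl

theorem pushChain_mem_cycles (f : N → M) (hf : ContMDiff (𝓡 e) (𝓡 d) ∞ f) (n : ℕ) :
    cycles e N n ≤ (cycles d M n).comap (pushChain f hf n) := by
  cases n with
  | zero => exact fun _ _ => AddSubgroup.mem_top _
  | succ n =>
      intro c hc
      change bdry d M n _ = 0
      rw [bdry_pushChain, AddMonoidHom.mem_ker.1 hc, map_zero]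

/-- The push-forward `f_* : H_n(N; ℤ) → H_n(M; ℤ)` of a smooth map `f`. -/
noncomputable def pushHomology (f : N → M) (hf : ContMDiff (𝓡 e) (𝓡 d) ∞ f) (n : ℕ) :
    Homology e N n →+ Homology d M n :=
  QuotientAddGroup.map _ _
    (((pushChain f hf n).comp (cycles e N n).subtype).codRestrict (cycles d M n)
      fun c => pushChain_mem_cycles f hf n c.2) (by
    rintro ⟨c, hc⟩ ⟨b, hb⟩
    refine ⟨pushChain f hf (n + 1) b, ?_⟩
    rw [bdry_pushChain, hb]
    rfl)

end Pushforward

section Cohomology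

variable (d : ℕ) (M : Type*) [TopologicalSpace M] [ChartedSpace (EuclideanSpace ℝ (Fin d)) M]
  (R : Type*) [CommRing R]

/-- Cochains `C^n(M; R) = Hom(C_n(M; ℤ), R)`. -/
abbrev Cochain (n : ℕ) : Type _ := Chain d M n →+ R

/-- The coboundary `δ φ = φ ∘ ∂`. -/
noncomputable def cobdry (n : ℕ) : Cochain d M R n →+ Cochain d M R (n + 1) where
  toFun φ := φ.comp (bdry d M n)
  map_zero' := rfl
  map_add' _ _ := rfl

/-- Coboundaries; in degree `0` there are none but `0`. -/
noncomputable def coboundaries : (n : ℕ) → AddSubgroup (Cochain d M R n)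
  | 0 => ⊥
  | n + 1 => (cobdry d M R n).range

noncomputable def cocycles (n : ℕ) : AddSubgroup (Cochain d M R n) := (cobdry d M R n).ker

/-- Smooth singular cohomology `H^n(M; R)`. -/
abbrev Cohomology (n : ℕ) : Type _ :=
  cocycles d M R n ⧸ (coboundaries d M R n).addSubgroupOf (cocycles d M R n)

variable {d M R}

/-- The cup product of cochains:
`(φ ⌣ ψ)(σ) = φ(σ|[v₀, …, v_p]) ψ(σ|[v_p, …, v_{p + q}])`. -/
noncomputable def cupCochain {p q n : ℕ} (h : p + q = n) (φ : Cochain d M R p)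
    (ψ : Cochain d M R q) : Cochain d M R n :=
  liftChain fun σ =>
    φ (σ.comp fun i : Fin (p + 1) => (⟨i, by omega⟩ : Fin (n + 1))).chain *
      ψ (σ.comp fun i : Fin (q + 1) => (⟨p + i, by omega⟩ : Fin (n + 1))).chain

theorem cupCochain_chain {p q n : ℕ} (h : p + q = n) (φ : Cochain d M R p)
    (ψ : Cochain d M R q) (σ : SmoothSimplex d M n) :
    cupCochain h φ ψ σ.chain =
    φ (σ.comp fun i : Fin (p + 1) => (⟨i, by omega⟩ : Fin (n + 1))).chain *
      ψ (σ.comp fun i : Fin (q + 1) => (⟨p + i, by omega⟩ : Fin (n + 1))).chain :=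
  liftChain_chain _ _

theorem cupCochain_add_left {p q n : ℕ} (h : p + q = n) (φ φ' : Cochain d M R p)
    (ψ : Cochain d M R q) :
    cupCochain h (φ + φ') ψ = cupCochain h φ ψ + cupCochain h φ' ψ :=
  chain_hom_ext fun σ => by simp [cupCochain_chain, add_mul]

theorem cupCochain_add_right {p q n : ℕ} (h : p + q = n) (φ : Cochain d M R p)
    (ψ ψ' : Cochain d M R q) :
    cupCochain h φ (ψ + ψ') = cupCochain h φ ψ + cupCochain h φ ψ' :=
  chain_hom_ext fun σ => by simp [cupCochain_chain, mul_add]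

theorem succAbove_val {n : ℕ} (i : Fin (n + 1)) (j : Fin n) :
    (i.succAbove j : ℕ) = if (j : ℕ) < i then (j : ℕ) else j + 1 := by
  rw [Fin.succAbove]
  split_ifs <;> simp_all [Fin.lt_def]

set_option linter.unusedSimpArgs false in
/-- `δ (φ ⌣ ψ) = δ φ ⌣ ψ + (-1)^p φ ⌣ δ ψ` -/
theorem cobdry_cupCochain {p q n : ℕ} (h : p + q = n) (φ : Cochain d M R p)
    (ψ : Cochain d M R q) :
    cobdry d M R n (cupCochain h φ ψ) =
      cupCochain (by omega : p + 1 + q = n + 1) (cobdry d M R p φ) ψ +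
        (-1 : ℤ) ^ p • cupCochain (by omega : p + (q + 1) = n + 1) φ (cobdry d M R q ψ) := by
  subst h
  refine chain_hom_ext fun σ => ?_
  have hc : p + 1 + (q + 1) = p + q + 2 := by omega
  simp only [cobdry, AddMonoidHom.coe_mk, ZeroHom.coe_mk, AddMonoidHom.comp_apply, bdry,
    AddMonoidHom.add_apply, AddMonoidHom.coe_smul, Pi.smul_apply,
    liftChain_chain, cupCochain_chain, map_sum, map_zsmul, SmoothSimplex.comp_comp]
  rw [← Fin.sum_congr' _ hc, Fin.sum_univ_add, Fin.sum_univ_castSucc (n := p + 1),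
    Fin.sum_univ_succ (n := q + 1), add_mul, mul_add, smul_add, Finset.sum_mul, Finset.mul_sum,
    Finset.smul_sum]
  have e1 (i : Fin (p + 1)) : σ.comp ((Fin.succAbove (Fin.cast hc (Fin.castAdd (q + 1) i))) ∘
      fun i : Fin (p + 1) => (⟨i, by omega⟩ : Fin (p + q + 1))) =
      σ.comp ((fun i : Fin (p + 1 + 1) => (⟨i, by omega⟩ : Fin (p + q + 1 + 1))) ∘
        Fin.succAbove i.castSucc) := by
    congr 1; funext j; ext
    simp only [Function.comp_apply, succAbove_val, Fin.val_cast, Fin.val_castAdd, Fin.val_natAdd,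
      Fin.val_castSucc, Fin.val_last, Fin.val_zero, Fin.val_succ]
  have e2 (i : Fin (p + 1)) : σ.comp ((Fin.succAbove (Fin.cast hc (Fin.castAdd (q + 1) i))) ∘
      fun i : Fin (q + 1) => (⟨p + i, by omega⟩ : Fin (p + q + 1))) =
      σ.comp (fun i : Fin (q + 1) => (⟨p + 1 + i, by omega⟩ : Fin (p + q + 1 + 1))) := by
    congr 1; funext j; ext
    simp only [Function.comp_apply, succAbove_val, Fin.val_cast, Fin.val_castAdd, Fin.val_natAdd,
      Fin.val_castSucc, Fin.val_last, Fin.val_zero, Fin.val_succ]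
    split_ifs <;> omega
  have e3 (i : Fin (q + 1)) : σ.comp ((Fin.succAbove (Fin.cast hc (Fin.natAdd (p + 1) i))) ∘
      fun i : Fin (p + 1) => (⟨i, by omega⟩ : Fin (p + q + 1))) =
      σ.comp (fun i : Fin (p + 1) => (⟨i, by omega⟩ : Fin (p + q + 1 + 1))) := by
    congr 1; funext j; ext
    simp only [Function.comp_apply, succAbove_val, Fin.val_cast, Fin.val_castAdd, Fin.val_natAdd,
      Fin.val_castSucc, Fin.val_last, Fin.val_zero, Fin.val_succ]
    split_ifs <;> omega
  have e4 (i : Fin (q + 1)) : σ.comp ((Fin.succAbove (Fin.cast hc (Fin.natAdd (p + 1) i))) ∘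
      fun i : Fin (q + 1) => (⟨p + i, by omega⟩ : Fin (p + q + 1))) =
      σ.comp ((fun i : Fin (q + 1 + 1) => (⟨p + i, by omega⟩ : Fin (p + q + 1 + 1))) ∘
        Fin.succAbove i.succ) := by
    congr 1; funext j; ext
    simp only [Function.comp_apply, succAbove_val, Fin.val_cast, Fin.val_castAdd, Fin.val_natAdd,
      Fin.val_castSucc, Fin.val_last, Fin.val_zero, Fin.val_succ]
    split_ifs <;> omega
  have e5 : σ.comp ((fun i : Fin (p + 1 + 1) => (⟨i, by omega⟩ : Fin (p + q + 1 + 1))) ∘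
        Fin.succAbove (Fin.last (p + 1))) =
      σ.comp (fun i : Fin (p + 1) => (⟨i, by omega⟩ : Fin (p + q + 1 + 1))) := by
    congr 1; funext j; ext
    simp only [Function.comp_apply, succAbove_val, Fin.val_cast, Fin.val_castAdd, Fin.val_natAdd,
      Fin.val_castSucc, Fin.val_last, Fin.val_zero, Fin.val_succ]
    split_ifs <;> omega
  have e6 : σ.comp ((fun i : Fin (q + 1 + 1) => (⟨p + i, by omega⟩ : Fin (p + q + 1 + 1))) ∘
        Fin.succAbove 0) =
      σ.comp (fun i : Fin (q + 1) => (⟨p + 1 + i, by omega⟩ : Fin (p + q + 1 + 1))) := by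
    congr 1; funext j; ext
    simp only [Function.comp_apply, succAbove_val, Fin.val_cast, Fin.val_castAdd, Fin.val_natAdd,
      Fin.val_castSucc, Fin.val_last, Fin.val_zero, Fin.val_succ]
    simp only [Nat.not_lt_zero, if_false]
    omega
  simp only [e1, e2, e3, e4, e5, e6]
  simp only [Fin.val_cast, Fin.val_castAdd, Fin.val_natAdd, Fin.val_castSucc, Fin.val_last,
    Fin.val_zero, Fin.val_succ, zsmul_eq_mul, Int.cast_pow, Int.cast_neg, Int.cast_one]
  have key : ∀ {x y x' y' z w : R}, x = x' → y = y' → z + w = 0 →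
      x + y = x' + z + (w + y') := by
    rintro x y _ _ z w rfl rfl h
    linear_combination -h
  exact key (Finset.sum_congr rfl fun i _ => by ring) (Finset.sum_congr rfl fun i _ => by ring)
    (by ring)

theorem cup_mem_cocycles {p q n : ℕ} (h : p + q = n) {φ : Cochain d M R p}
    {ψ : Cochain d M R q} (hφ : φ ∈ cocycles d M R p) (hψ : ψ ∈ cocycles d M R q) :
    cupCochain h φ ψ ∈ cocycles d M R n := by
  have e1 : cobdry d M R p φ = 0 := hφ
  have e2 : cobdry d M R q ψ = 0 := hψ
  change cobdry d M R n _ = 0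
  rw [cobdry_cupCochain, e1, e2]
  exact chain_hom_ext fun σ => by simp [cupCochain_chain]

theorem cup_mem_coboundaries_left {p q n : ℕ} (h : p + q = n) {φ : Cochain d M R p}
    {ψ : Cochain d M R q} (hφ : φ ∈ coboundaries d M R p) (hψ : ψ ∈ cocycles d M R q) :
    cupCochain h φ ψ ∈ coboundaries d M R n := by
  have e2 : cobdry d M R q ψ = 0 := hψ
  cases p with
  | zero =>
    have e : cupCochain h φ ψ = 0 := by
      rw [show φ = 0 from hφ]
      exact chain_hom_ext fun σ => by simp [cupCochain_chain]
    rw [e]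
    exact zero_mem _
  | succ p =>
    obtain ⟨χ, rfl⟩ := hφ
    obtain ⟨n, rfl⟩ : ∃ n', n = n' + 1 := ⟨p + q, by omega⟩
    refine ⟨cupCochain (by omega) χ ψ, ?_⟩
    rw [cobdry_cupCochain, e2]
    exact chain_hom_ext fun σ => by simp [cupCochain_chain]

theorem cup_mem_coboundaries_right {p q n : ℕ} (h : p + q = n) {φ : Cochain d M R p}
    {ψ : Cochain d M R q} (hφ : φ ∈ cocycles d M R p) (hψ : ψ ∈ coboundaries d M R q) :
    cupCochain h φ ψ ∈ coboundaries d M R n := by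
  have e1 : cobdry d M R p φ = 0 := hφ
  cases q with
  | zero =>
    have e : cupCochain h φ ψ = 0 := by
      rw [show ψ = 0 from hψ]
      exact chain_hom_ext fun σ => by simp [cupCochain_chain]
    rw [e]
    exact zero_mem _
  | succ q =>
    obtain ⟨χ, rfl⟩ := hψ
    obtain ⟨n, rfl⟩ : ∃ n', n = n' + 1 := ⟨p + q, by omega⟩
    refine ⟨(-1 : ℤ) ^ p • cupCochain (by omega) φ χ, ?_⟩
    rw [map_zsmul, cobdry_cupCochain, e1, smul_add, smul_smul, ← mul_pow]
    exact chain_hom_ext fun σ => by simp [cupCochain_chain]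

/-- The cup product `⌣ : H^p(M; R) × H^q(M; R) → H^{p+q}(M; R)`. -/
noncomputable def cup {p q n : ℕ} (h : p + q = n) :
    Cohomology d M R p →+ Cohomology d M R q →+ Cohomology d M R n :=
  QuotientAddGroup.lift _
    (AddMonoidHom.mk' (fun φ : cocycles d M R p =>
      QuotientAddGroup.map _ _
        (AddMonoidHom.mk' (fun ψ : cocycles d M R q =>
            (⟨cupCochain h φ.1 ψ.1, cup_mem_cocycles h φ.2 ψ.2⟩ : cocycles d M R n))
          fun ψ ψ' => Subtype.ext (cupCochain_add_right h φ.1 ψ.1 ψ'.1))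
        fun _ hψ => cup_mem_coboundaries_right h φ.2 hψ)
      fun φ φ' => by
        ext ψ
        exact congrArg (QuotientAddGroup.mk (s := (coboundaries d M R n).addSubgroupOf _))
          (Subtype.ext (cupCochain_add_left h φ.1 φ'.1 ψ.1)))
    (by
      intro φ hφ
      ext ψ
      exact (QuotientAddGroup.eq_zero_iff _).2 (cup_mem_coboundaries_left h hφ ψ.2))

/-- Evaluation of cohomology classes on homology classes. -/
noncomputable def eval (n : ℕ) : Cohomology d M R n →+ Homology d M n →+ R :=
  QuotientAddGroup.lift _
    (AddMonoidHom.mk' (fun φ : cocycles d M R n =>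
      QuotientAddGroup.lift _ (φ.1.comp (cycles d M n).subtype) (by
        rintro ⟨_, hc⟩ ⟨b, rfl⟩
        exact DFunLike.congr_fun (show cobdry d M R n φ.1 = 0 from φ.2) b))
      fun φ φ' => by ext c; rfl)
    (by
      rintro ⟨φ, hφ⟩ h
      ext ⟨c, hc⟩
      cases n with
      | zero => exact DFunLike.congr_fun (show φ = 0 from h) c
      | succ n =>
        obtain ⟨χ, rfl⟩ := h
        change χ (bdry d M n c) = 0
        rw [AddMonoidHom.mem_ker.1 hc, map_zero])

end Cohomology

section Coefficients

variable (d : ℕ) (M : Type*) [TopologicalSpace M] [ChartedSpace (EuclideanSpace ℝ (Fin d)) M]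

/-- Integral cochains as real cochains. -/
noncomputable def toRealCochain (n : ℕ) : Cochain d M ℤ n →+ Cochain d M ℝ n :=
  AddMonoidHom.compHom (Int.castAddHom ℝ)

theorem toRealCochain_mem_cocycles {n : ℕ} {φ : Cochain d M ℤ n} (h : φ ∈ cocycles d M ℤ n) :
    toRealCochain d M n φ ∈ cocycles d M ℝ n := by
  change toRealCochain d M (n + 1) (cobdry d M ℤ n φ) = 0
  rw [show cobdry d M ℤ n φ = 0 from h, map_zero]

theorem toRealCochain_mem_coboundaries {n : ℕ} {φ : Cochain d M ℤ n}
    (h : φ ∈ coboundaries d M ℤ n) : toRealCochain d M n φ ∈ coboundaries d M ℝ n := by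
  cases n with
  | zero =>
    rw [show φ = 0 from h, map_zero]
    exact zero_mem _
  | succ n =>
    obtain ⟨χ, rfl⟩ := h
    exact ⟨toRealCochain d M n χ, rfl⟩

/-- The change of coefficients `H^n(M; ℤ) → H^n(M; ℝ)`. -/
noncomputable def toReal (n : ℕ) : Cohomology d M ℤ n →+ Cohomology d M ℝ n :=
  QuotientAddGroup.map _ _
    (((toRealCochain d M n).comp (cocycles d M ℤ n).subtype).codRestrict (cocycles d M ℝ n)
      fun φ => toRealCochain_mem_cocycles d M φ.2)
    fun _ h => toRealCochain_mem_coboundaries d M h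

theorem cohomology_real_torsionFree (n : ℕ) (x : Cohomology d M ℝ n) (k : ℕ) (hk : k ≠ 0)
    (hx : k • x = 0) : x = 0 := by
  obtain ⟨φ, rfl⟩ := QuotientAddGroup.mk_surjective x
  have h : k • φ.1 ∈ coboundaries d M ℝ n := (QuotientAddGroup.eq_zero_iff (k • φ)).1 hx
  refine (QuotientAddGroup.eq_zero_iff φ).2 ?_
  have hk' : (k : ℝ) ≠ 0 := Nat.cast_ne_zero.2 hk
  change φ.1 ∈ coboundaries d M ℝ n
  cases n with
  | zero =>
    refine AddMonoidHom.ext fun c => ?_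
    have := DFunLike.congr_fun (show k • φ.1 = 0 from h) c
    simpa [hk] using this
  | succ n =>
    obtain ⟨χ, hχ⟩ := h
    refine ⟨(AddMonoidHom.mulLeft ((k : ℝ)⁻¹)).comp χ, AddMonoidHom.ext fun c => ?_⟩
    have h2 : χ (bdry d M n c) = k • φ.1 c := DFunLike.congr_fun hχ c
    change (k : ℝ)⁻¹ * χ (bdry d M n c) = φ.1 c
    rw [h2, nsmul_eq_mul, inv_mul_cancel_left₀ hk']

/-- `H^n_free(M; ℤ)`, the quotient of `H^n(M; ℤ)` by its torsion subgroup. -/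
abbrev FreeCohomology (n : ℕ) : Type _ :=
  Cohomology d M ℤ n ⧸ AddCommGroup.torsion (Cohomology d M ℤ n)

/-- The map `H^n_free(M; ℤ) → H^n(M; ℝ)`. -/
noncomputable def freeToReal (n : ℕ) : FreeCohomology d M n →+ Cohomology d M ℝ n :=
  QuotientAddGroup.lift _ (toReal d M n) (by
    intro x hx
    obtain ⟨k, hk, h⟩ := (isOfFinAddOrder_iff_nsmul_eq_zero).1 hx
    refine cohomology_real_torsionFree d M n _ k hk.ne' ?_
    rw [← map_nsmul, h, map_zero])

/-- The torus `H^n(M; ℝ) / H^n_free(M; ℤ)`. -/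
abbrev TorusCohomology (n : ℕ) : Type _ := Cohomology d M ℝ n ⧸ (freeToReal d M n).range

variable {d M}

theorem eval_cup_toReal {p q n : ℕ} (h : p + q = n) (x : Cohomology d M ℤ p)
    (y : Cohomology d M ℤ q) (c : Homology d M n) :
    eval n (cup h (toReal d M p x) (toReal d M q y)) c = ((eval n (cup h x y) c : ℤ) : ℝ) := by
  obtain ⟨φ, rfl⟩ := QuotientAddGroup.mk_surjective x
  obtain ⟨ψ, rfl⟩ := QuotientAddGroup.mk_surjective y
  obtain ⟨c, rfl⟩ := QuotientAddGroup.mk_surjective c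
  have e : cupCochain h (toRealCochain d M p φ.1) (toRealCochain d M q ψ.1) =
      toRealCochain d M n (cupCochain h φ.1 ψ.1) :=
    chain_hom_ext fun σ => by simp [cupCochain_chain, toRealCochain]
  exact DFunLike.congr_fun e c.1

/-- `(θ, y) ↦ (θ ⌣ y)(c) mod ℤ` for `θ ∈ H^p(M; ℝ)`, `y ∈ H^q_free(M; ℤ)` and a homology class `c`
of degree `n = p + q`. -/
noncomputable def realPairing {p q n : ℕ} (h : p + q = n) (c : Homology d M n) :
    Cohomology d M ℝ p →+ FreeCohomology d M q →+ UnitAddCircle where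
  toFun θ :=
    { toFun := fun y => ((eval n (cup h θ (freeToReal d M q y)) c : ℝ) : UnitAddCircle)
      map_zero' := by
        rw [map_zero, map_zero, map_zero]
        rfl
      map_add' := fun y y' => by
        rw [map_add, map_add, map_add]
        rfl }
  map_zero' := AddMonoidHom.ext fun y => by
    change ((eval n (cup h 0 (freeToReal d M q y)) c : ℝ) : UnitAddCircle) = 0
    rw [map_zero, AddMonoidHom.zero_apply, map_zero]
    rfl
  map_add' θ θ' := AddMonoidHom.ext fun y => by
    change ((eval n (cup h (θ + θ') (freeToReal d M q y)) c : ℝ) : UnitAddCircle) = _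
    rw [map_add, AddMonoidHom.add_apply, map_add]
    rfl

theorem realPairing_freeToReal {p q n : ℕ} (h : p + q = n) (c : Homology d M n)
    (x : FreeCohomology d M p) (y : FreeCohomology d M q) :
    realPairing h c (freeToReal d M p x) y = 0 := by
  obtain ⟨x, rfl⟩ := QuotientAddGroup.mk_surjective x
  obtain ⟨y, rfl⟩ := QuotientAddGroup.mk_surjective y
  change ((eval n (cup h (toReal d M p x) (toReal d M q y)) c : ℝ) : UnitAddCircle) = 0
  rw [eval_cup_toReal]
  exact (AddCircle.coe_eq_zero_iff 1).2 ⟨eval n (cup h x y) c, zsmul_one _⟩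

/-- The pairing `H^p(M; ℝ) / H^p_free(M; ℤ) × H^q_free(M; ℤ) → 𝕋`,
`([θ], y) ↦ (θ ⌣ y)(c) mod ℤ`, for a homology class `c` of degree `n = p + q`. -/
noncomputable def pairing {p q n : ℕ} (h : p + q = n) (c : Homology d M n) :
    TorusCohomology d M p →+ FreeCohomology d M q →+ UnitAddCircle :=
  QuotientAddGroup.lift _ (realPairing h c) (by
    rintro _ ⟨x, rfl⟩
    exact AddMonoidHom.ext fun y => realPairing_freeToReal h c x y)

end Coefficients
end TopSector

namespace TopSector

section Geometry

variable (m : ℕ) (M : Type*) [TopologicalSpace M] [ChartedSpace (EuclideanSpace ℝ (Fin m)) M]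
  [IsManifold (𝓡 m) ∞ M]

/-- A time-oriented Lorentzian metric of signature `(m - 1, 1)`: a smooth field of symmetric
bilinear forms, each of which is negative on some line and positive definite on its orthogonal
complement, with a continuous timelike vector field `timeDir` (the time orientation). -/
structure Spacetime where
  metric (x : M) : TangentSpace (𝓡 m) x →L[ℝ] TangentSpace (𝓡 m) x →L[ℝ] ℝ
  symm : ∀ x v w, metric x v w = metric x w v
  signature : ∀ x, ∃ v, metric x v v < 0 ∧ ∀ w, metric x v w = 0 → w ≠ 0 → 0 < metric x w w
  contMDiff : ContMDiff (𝓡 m) ((𝓡 m).prod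
      𝓘(ℝ, EuclideanSpace ℝ (Fin m) →L[ℝ] EuclideanSpace ℝ (Fin m) →L[ℝ] ℝ)) ∞
    (fun x => Bundle.TotalSpace.mk'
      (EuclideanSpace ℝ (Fin m) →L[ℝ] EuclideanSpace ℝ (Fin m) →L[ℝ] ℝ)
      (E := fun x : M => TangentSpace (𝓡 m) x →L[ℝ] TangentSpace (𝓡 m) x →L[ℝ] ℝ) x (metric x))
  timeDir (x : M) : TangentSpace (𝓡 m) x
  continuous_timeDir : Continuous fun x =>
    (Bundle.TotalSpace.mk x (timeDir x) : TangentBundle (𝓡 m) M)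
  timelike_timeDir : ∀ x, metric x (timeDir x) (timeDir x) < 0

end Geometry

namespace Spacetime

variable {m : ℕ} {M : Type*} [TopologicalSpace M] [ChartedSpace (EuclideanSpace ℝ (Fin m)) M]
  [IsManifold (𝓡 m) ∞ M] (g : Spacetime m M)

/-- The velocity of a curve. -/
noncomputable def velocity (γ : ℝ → M) (t : ℝ) : TangentSpace (𝓡 m) (γ t) :=
  mfderiv 𝓘(ℝ, ℝ) (𝓡 m) γ t (1 : ℝ)

/-- Tangent vectors that are causal (timelike or null, and nonzero) and future-directed. -/
def IsFutureCausal {x : M} (v : TangentSpace (𝓡 m) x) : Prop :=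
  g.metric x v v ≤ 0 ∧ g.metric x (g.timeDir x) v < 0

/-- Tangent vectors that are timelike and future-directed. -/
def IsFutureTimelike {x : M} (v : TangentSpace (𝓡 m) x) : Prop :=
  g.metric x v v < 0 ∧ g.metric x (g.timeDir x) v < 0

/-- `y` lies in the chronological future of `x`. -/
def ChronologicallyPrecedes (x y : M) : Prop :=
  ∃ (γ : ℝ → M) (a b : ℝ), a < b ∧ γ a = x ∧ γ b = y ∧
    ∃ U : Set ℝ, IsOpen U ∧ Set.Icc a b ⊆ U ∧ ContMDiffOn 𝓘(ℝ, ℝ) (𝓡 m) 1 γ U ∧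
      ∀ t ∈ Set.Icc a b, g.IsFutureTimelike (velocity γ t)

/-- No two points of `S` are joined by a timelike curve. -/
def IsAchronal (S : Set M) : Prop := ∀ x ∈ S, ∀ y ∈ S, ¬ g.ChronologicallyPrecedes x y

/-- Future-directed causal curves `ℝ → M` without future and past endpoints. -/
def IsInextendibleCausal (γ : ℝ → M) : Prop :=
  ContMDiff 𝓘(ℝ, ℝ) (𝓡 m) 1 γ ∧ (∀ t, g.IsFutureCausal (velocity γ t)) ∧
    (∀ x, ¬ Filter.Tendsto γ Filter.atTop (nhds x)) ∧
    (∀ x, ¬ Filter.Tendsto γ Filter.atBot (nhds x))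

/-- The points `p` such that every inextendible causal curve through `p` meets `S`. -/
def domainOfDependence (S : Set M) : Set M :=
  {p | ∀ γ, g.IsInextendibleCausal γ → p ∈ Set.range γ → (Set.range γ ∩ S).Nonempty}

/-- A Cauchy surface is a closed achronal set whose domain of dependence is everything. -/
def IsCauchySurface (S : Set M) : Prop :=
  IsClosed S ∧ g.IsAchronal S ∧ g.domainOfDependence S = Set.univ

end Spacetime
end TopSector

namespace TopSector

section TopologicalSector

variable (m : ℕ) (M : Type*) [TopologicalSpace M] [ChartedSpace (EuclideanSpace ℝ (Fin m)) M]

/-- The group `H^{k-1,m-k-1}(M; ℝ) / H_free^{k-1,m-k-1}(M; ℤ) × H_free^{k,m-k}(M; ℤ)`, where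
`G^{p,q} = G^p × G^q`. Its elements are written `(u, ũ, v, ṽ)`. -/
abbrev TopGroup (k : ℕ) : Type _ :=
  TorusCohomology m M (k - 1) × TorusCohomology m M (m - k - 1) ×
    FreeCohomology m M k × FreeCohomology m M (m - k)

variable {m M} {k : ℕ}

/-- For `1 ≤ k ≤ m - 1` and `c = [Σ] ∈ H_{m-1}(M; ℤ)`, the pre-symplectic form
`τ((u, ũ, v, ṽ), (u', ũ', v', ṽ')) = ⟨ũ, v'⟩ - s ⟨u, ṽ'⟩ - ⟨ũ', v⟩ + s ⟨u', ṽ⟩`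
with `s = (-1)^{k(m-k)}`. -/
noncomputable def tauLR (hk : 1 ≤ k) (hkm : k + 1 ≤ m) (c : Homology m M (m - 1)) :
    PreSymplectic (TopGroup m M k) where
  form :=
    AddMonoidHom.mk' (fun x =>
      AddMonoidHom.mk' (fun y =>
        pairing (show m - k - 1 + k = m - 1 by omega) c x.2.1 y.2.2.1
          - (-1 : ℤ) ^ (k * (m - k)) • pairing (show k - 1 + (m - k) = m - 1 by omega) c x.1 y.2.2.2
          - pairing (show m - k - 1 + k = m - 1 by omega) c y.2.1 x.2.2.1
          + (-1 : ℤ) ^ (k * (m - k)) •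
              pairing (show k - 1 + (m - k) = m - 1 by omega) c y.1 x.2.2.2)
        fun y y' => by
          simp only [Prod.fst_add, Prod.snd_add, map_add, AddMonoidHom.add_apply, smul_add]
          abel)
      fun x x' => AddMonoidHom.ext fun y => by
        simp only [AddMonoidHom.mk'_apply, Prod.fst_add, Prod.snd_add, map_add,
          AddMonoidHom.add_apply, smul_add]
        abel
  alt x := by
    simp only [AddMonoidHom.mk'_apply]
    abel

end TopologicalSector

end TopSector

open TopSector

/-! Let `π` be the projection of the group onto its free part `(v, ṽ)`. The required functional is
the indicator of `ker π` on Weyl symbols. On each fibre of `π` the form is a difference: if `π x = π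
y` then `τ(x, y) = χ x - χ y` with `χ(u, ũ, v, ṽ) = ⟨ũ, v⟩ - s ⟨u, ṽ⟩` (`gaugePhase`). In particular
`ker π` is isotropic. When `x` and `y` share a fibre, `(W x)⋆ W y` therefore has expectation
`exp(2πi(χ y - χ x))`, and otherwise expectation zero. Summing coefficients, weighted by `exp(2πi
χ)`, over each fibre sends `a` to a finitely supported function `â`, and the functional becomes
`ω(a⋆ b) = ∑ conj(â(v)) b̂(v)` (`kerFunctional_star_mul`). Positivity is then evident.

The minimal regular norm dominates every state, so `ω` extends to the completion. Positivity passes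
to limits, and density of the span of the Weyl symbols gives uniqueness.

If `π x = 0`, then `ω` is `1` on both `W x` and `W (-x)`, so `W x - 1` is a null vector
(`star_W_sub_one_mul_self`). For `x ≠ 0` it is a nonzero element, because the Weyl generators remain
distinct in the completion (`W_injective`); this rules out faithfulness. By Cauchy–Schwarz the null
vectors form a left ideal, and multiplying `W x - 1` on the left by a multiple of `W y` yields the
relation between generators (`W_add_sub_mem_gelfandIdeal`). No non-degeneracy of the pairings
enters. -/

namespace TopSector

open scoped ComplexOrder

/-! ### States on unital `*`-algebras and their null ideals -/

section States

variable {A : Type*} [Ring A] [StarRing A] [Algebra ℂ A] [StarModule ℂ A]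

/-- The semi-inner product `(a, b) ↦ φ (a⋆ b)` of a state on a unital `*`-algebra. -/
@[reducible]
noncomputable def IsState.core {φ : A →ₗ[ℂ] ℂ} (hφ : IsState φ) :
    PreInnerProductSpace.Core ℂ A where
  inner a b := φ (star a * b)
  re_inner_nonneg a := (Complex.le_def.1 (hφ.1 a)).1
  add_left a b c := by simp [add_mul]
  smul_left a b c := by simp
  conj_inner_symm a b := by
    have key (c : A) : (φ (star c * c)).im = 0 := (Complex.le_def.1 (hφ.1 c)).2.symm
    -- Polarization: `a + b` shows that `φ (a⋆ b)` and `φ (b⋆ a)` have opposite imaginary parts, `a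
    -- + i b` that their real parts agree.
    have h1 := key (a + b)
    have h2 := key (a + Complex.I • b)
    simp [add_mul, mul_add, key] at h1 h2
    apply Complex.ext
    · simp; linarith
    · simp; linarith

/-- Cauchy–Schwarz: a null vector is orthogonal to everything. Both ideal properties below rest on
this. -/
theorem IsState.apply_star_mul_eq_zero {φ : A →ₗ[ℂ] ℂ} (hφ : IsState φ) {a : A}
    (ha : φ (star a * a) = 0) (b : A) : φ (star b * a) = 0 := by
  have h : ‖φ (star b * a)‖ ≤ √ (φ (star b * b)).re * √ (φ (star a * a)).re :=
    @InnerProductSpace.Core.norm_inner_le_norm ℂ _ _ _ _ hφ.core b a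
  rw [ha, Complex.zero_re, Real.sqrt_zero, mul_zero] at h
  exact norm_le_zero_iff.1 h

/-- The Gelfand ideal `{a | φ (a⋆ a) = 0}` of a state. -/
def IsState.gelfandIdeal {φ : A →ₗ[ℂ] ℂ} (hφ : IsState φ) : Ideal A where
  carrier := {a | φ (star a * a) = 0}
  zero_mem' := by simp
  add_mem' {a b} (ha hb) := by
    have ha' := hφ.apply_star_mul_eq_zero ha
    have hb' := hφ.apply_star_mul_eq_zero hb
    rw [Set.mem_ofPred_eq, mul_add, map_add, ha', hb', add_zero]
  smul_mem' b a ha := by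
    -- The test element is chosen so that its adjoint times `a` is `(b a)⋆ (b a)`.
    have h := hφ.apply_star_mul_eq_zero ha (star b * (b * a))
    simpa [mul_assoc] using h

theorem IsState.mem_gelfandIdeal {φ : A →ₗ[ℂ] ℂ} (hφ : IsState φ) {a : A} :
    a ∈ hφ.gelfandIdeal ↔ φ (star a * a) = 0 := Iff.rfl

end States

variable {G V : Type*} [AddCommGroup G] [AddCommGroup V] {τ : PreSymplectic G}

/-! ### The indicator functional of a kernel on the algebraic Weyl algebra -/

namespace WeylAlg₀

open Classical in
/-- The functional on the Weyl algebra that is `1` on `W x` if `π x = 0` and `0` otherwise. -/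
noncomputable def kerFunctional (τ : PreSymplectic G) (π : G →+ V) : WeylAlg₀ τ →ₗ[ℂ] ℂ :=
  Finsupp.linearCombination ℂ (fun x => if π x = 0 then (1 : ℂ) else 0)

open Classical in
theorem kerFunctional_W (π : G →+ V) (x : G) :
    kerFunctional τ π (W τ x) = if π x = 0 then 1 else 0 := by
  rw [kerFunctional, W]
  erw [Finsupp.linearCombination_single, one_smul]

/-- The map `W x ↦ exp (2 π i χ(x)) δ_{π x}` onto finitely supported functions. -/
noncomputable def fiberSum (τ : PreSymplectic G) (π : G →+ V) (χ : G → UnitAddCircle) :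
    WeylAlg₀ τ →ₗ[ℂ] (V →₀ ℂ) :=
  Finsupp.linearCombination ℂ (fun x => Finsupp.single (π x) (phase (χ x)))

theorem fiberSum_W (π : G →+ V) (χ : G → UnitAddCircle) (x : G) :
    fiberSum τ π χ (W τ x) = Finsupp.single (π x) (phase (χ x)) := by
  rw [fiberSum, W]
  erw [Finsupp.linearCombination_single, one_smul]

/-- The hypothesis trivializes the twist of the product along the fibres of `π`, with `χ` as
primitive; `χ` need not be additive. The semi-inner product is thus pulled back along `fiberSum`
from the standard one on finitely supported functions. Sesquilinearity reduces the claim to two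
generators. -/
theorem kerFunctional_star_mul (π : G →+ V) (χ : G → UnitAddCircle)
    (h : ∀ x y, π x = π y → τ.form x y = χ x - χ y) (a b : WeylAlg₀ τ) :
    kerFunctional τ π (star a * b) =
      (fiberSum τ π χ b).sum fun v z => star (fiberSum τ π χ a v) * z := by
  induction b using induct with
  | zero => simp
  | add b b' hb hb' =>
    rw [mul_add, map_add, map_add, hb, hb', Finsupp.sum_add_index'] <;> simp [mul_add]
  | smul s y =>
    rw [map_smul, fiberSum_W, Finsupp.smul_single, Finsupp.sum_single_index (by simp)]
    induction a using induct with
    | zero => simp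
    | add a a' ha ha' =>
      rw [star_add, add_mul, map_add, map_add, ha, ha', Finsupp.add_apply, star_add, add_mul]
    | smul r x =>
      rw [star_smul_W, smul_mul', mul_smul', W_mul_W, map_smul, map_smul, map_smul, map_smul,
        fiberSum_W, kerFunctional_W, Finsupp.smul_apply]
      by_cases e : π x = π y
      -- Same fibre: the phase exponent is `τ(-x, y) = χ y - χ x`, which splits into the conjugate
      -- of the weight of `x` and the weight of `y`.
      · rw [e, Finsupp.single_eq_same, if_pos (by simp [e]), map_neg, AddMonoidHom.neg_apply,
          h x y e, neg_sub, sub_eq_neg_add, phase_add]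
        simp only [smul_eq_mul, star_mul', star_phase]
        ring
      -- Different fibres: `-x + y` lies outside the kernel, and the two point masses have disjoint
      -- supports.
      · rw [Finsupp.single_eq_of_ne (Ne.symm e), if_neg]
        · simp
        · rwa [map_add, map_neg, neg_add_eq_zero]

theorem isState_kerFunctional (π : G →+ V) (χ : G → UnitAddCircle)
    (h : ∀ x y, π x = π y → τ.form x y = χ x - χ y) : IsState (kerFunctional τ π) := by
  refine ⟨fun a => ?_, by rw [one_def, kerFunctional_W, map_zero, if_pos rfl]⟩
  rw [kerFunctional_star_mul π χ h]
  exact Finset.sum_nonneg fun v _ => star_mul_self_nonneg _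

/-- Cauchy–Schwarz against `1`, then the supremum defining the norm. This is the bound that lets a
state extend to the completion. -/
theorem norm_apply_le {φ : WeylAlg₀ τ →ₗ[ℂ] ℂ} (hφ : IsState φ) (a : WeylAlg₀ τ) :
    ‖φ a‖ ≤ ‖a‖ := by
  have h := cauchy_schwarz hφ 1 a
  rw [star_one, one_mul, stateSeminorm_one hφ, one_mul] at h
  exact h.trans (stateSeminorm_le hφ a)

end WeylAlg₀

/-! ### Passage to the completion, uniqueness and null vectors -/

namespace CCR

/-- The canonical map of the Weyl `*`-algebra into its completion, as a continuous linear map. -/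
noncomputable def ofCLM (τ : PreSymplectic G) : WeylAlg₀ τ →L[ℂ] CCR τ where
  toFun := of
  map_add' := of_add
  map_smul' := of_smul
  cont := continuous_of

theorem denseRange_ofCLM : DenseRange (ofCLM τ) :=
  UniformSpace.Completion.denseRange_coe

theorem isUniformInducing_ofCLM : IsUniformInducing (ofCLM τ) :=
  UniformSpace.Completion.isUniformInducing_coe _

theorem W_mul_W (x y : G) : W τ x * W τ y = phase (τ.form x y) • W τ (x + y) := by
  rw [W, W, ← of_mul, WeylAlg₀.W_mul_W, of_smul, W]

theorem star_W (x : G) : star (W τ x) = W τ (-x) := by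
  rw [W, star_of, WeylAlg₀.star_W, W]

theorem star_W_mul_W (x : G) : star (W τ x) * W τ x = 1 := by
  rw [W, star_of, ← of_mul, WeylAlg₀.star_W_mul_W, of_one]

/-- The continuous extension of a state on the Weyl algebra. -/
noncomputable def extendState (φ : WeylAlg₀ τ →ₗ[ℂ] ℂ) (hφ : IsState φ) : CCR τ →L[ℂ] ℂ :=
  (φ.mkContinuous 1 fun a => by
    rw [one_mul]; exact WeylAlg₀.norm_apply_le hφ a).extend (ofCLM τ)

theorem extendState_of (φ : WeylAlg₀ τ →ₗ[ℂ] ℂ) (hφ : IsState φ) (a : WeylAlg₀ τ) :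
    extendState φ hφ (of a) = φ a :=
  ContinuousLinearMap.extend_eq _ denseRange_ofCLM isUniformInducing_ofCLM a

/-- Positivity is a closed condition in `a`, so it suffices to have it on the dense Weyl algebra. -/
theorem isState_of_comp (f : CCR τ →L[ℂ] ℂ)
    (h : IsState ((f : CCR τ →ₗ[ℂ] ℂ) ∘ₗ (ofCLM τ : WeylAlg₀ τ →ₗ[ℂ] CCR τ))) :
    IsState (f : CCR τ →ₗ[ℂ] ℂ) := by
  refine ⟨fun a => ?_, h.2⟩
  refine induct (p := fun a => 0 ≤ f (star a * a)) a ?_ fun a => ?_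
  · exact isClosed_le continuous_const (f.continuous.comp (continuous_star'.mul continuous_id))
  · rw [star_of, ← of_mul]
    exact h.1 a

/-- The Weyl generators span a dense subspace. All uniqueness claims come from here. -/
theorem clm_ext {f f' : CCR τ →L[ℂ] ℂ} (h : ∀ x, f (W τ x) = f' (W τ x)) : f = f' := by
  refine ContinuousLinearMap.ext fun a => ?_
  refine induct (p := fun a => f a = f' a) a (isClosed_eq f.continuous f'.continuous) fun a => ?_
  induction a using WeylAlg₀.induct with
  | zero => rw [show of (0 : WeylAlg₀ τ) = 0 from rfl, map_zero, map_zero]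
  | add a b ha hb => rw [of_add, map_add, map_add, ha, hb]
  | smul c x => rw [of_smul, map_smul, map_smul]; exact congrArg (c • ·) (h x)

/-- The completion is taken for what is only known to be a seminorm, so distinct symbols might be
identified. The state supported on `W 0` separates them: it is `1` on `(W x)⋆ W x` and `0` on `(W
x)⋆ W y` for `y ≠ x`. -/
theorem W_injective : Function.Injective (W τ) := by
  intro x y hxy
  have hφ : IsState (WeylAlg₀.kerFunctional τ (AddMonoidHom.id G)) :=
    -- For `π = id` the fibres are points, so alternation alone permits `χ = 0`.
    WeylAlg₀.isState_kerFunctional _ 0 fun x y e => by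
      rw [show x = y from e, τ.alt]; simp
  have h : extendState _ hφ (star (W τ x) * W τ x) = extendState _ hφ (star (W τ x) * W τ y) := by
    rw [hxy]
  by_contra hne
  rw [star_W_mul_W, star_W, W_mul_W, map_smul, W, ← of_one, extendState_of, extendState_of,
    WeylAlg₀.kerFunctional_W, AddMonoidHom.id_apply,
    if_neg (fun e => hne (neg_add_eq_zero.1 e)), hφ.2, smul_zero] at h
  exact one_ne_zero h

/-- Since `W x` is unitary, the product expands to `2 - W x - W (-x)`. -/
theorem star_W_sub_one_mul_self (f : CCR τ →L[ℂ] ℂ) {x : G}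
    (hx : f (W τ x) = 1) (hx' : f (W τ (-x)) = 1) (h1 : f 1 = 1) :
    f (star (W τ x - 1) * (W τ x - 1)) = 0 := by
  rw [star_sub, star_one, sub_mul, mul_sub, mul_sub, star_W_mul_W, star_W]
  simp [hx, hx', h1]

/-- The state on `CCR(G, τ)` that is `1` on `W x` for `π x = 0` and vanishes on the other
generators exists and is unique. -/
theorem existsUnique_kerState (π : G →+ V) (χ : G → UnitAddCircle)
    (h : ∀ x y, π x = π y → τ.form x y = χ x - χ y) :
    ∃! f : CCR τ →L[ℂ] ℂ,
      (∀ x, π x = 0 → f (W τ x) = 1) ∧ ∀ x, π x ≠ 0 → f (W τ x) = 0 := by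
  have hφ := WeylAlg₀.isState_kerFunctional π χ h
  have e (x : G) := (extendState_of _ hφ (WeylAlg₀.W τ x)).trans (WeylAlg₀.kerFunctional_W π x)
  refine ⟨extendState _ hφ, ⟨fun x hx => (e x).trans (if_pos hx),
    fun x hx => (e x).trans (if_neg hx)⟩, fun f hf => clm_ext fun x => (Eq.trans ?_ (e x).symm)⟩
  split_ifs with hx
  exacts [hf.1 x hx, hf.2 x hx]

/-- By density `f` must be the extension of `kerFunctional`, whose positivity is known. -/
theorem isState_kerState (π : G →+ V) (χ : G → UnitAddCircle)
    (h : ∀ x y, π x = π y → τ.form x y = χ x - χ y) (f : CCR τ →L[ℂ] ℂ)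
    (hf : (∀ x, π x = 0 → f (W τ x) = 1) ∧ ∀ x, π x ≠ 0 → f (W τ x) = 0) :
    IsState (f : CCR τ →ₗ[ℂ] ℂ) := by
  have hφ := WeylAlg₀.isState_kerFunctional π χ h
  have e : f = extendState _ hφ := clm_ext fun x => by
    refine Eq.trans ?_ ((extendState_of _ hφ (WeylAlg₀.W τ x)).trans
      (WeylAlg₀.kerFunctional_W π x)).symm
    split_ifs with hx
    exacts [hf.1 x hx, hf.2 x hx]
  refine isState_of_comp f ?_
  convert hφ
  exact LinearMap.ext fun a => (congrArg (fun f => f (of a)) e).trans (extendState_of _ hφ a)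

theorem not_isFaithful_kerState (π : G →+ V) (f : CCR τ →L[ℂ] ℂ)
    (hf : ∀ x, π x = 0 → f (W τ x) = 1) {x : G} (hx : π x = 0) (hx0 : x ≠ 0) :
    ¬ IsFaithful (f : CCR τ →ₗ[ℂ] ℂ) := fun hfaith =>
  hx0 <| W_injective <| sub_eq_zero.1 <| hfaith _ <|
    star_W_sub_one_mul_self f (hf x hx) (hf (-x) (by rw [map_neg, hx, neg_zero]))
      (hf 0 (map_zero π))

/-- The element is a left multiple of the null vector `W x - 1`: the factor `phase (-τ(y, x))`
cancels the twist in `W y * W x`. -/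
theorem W_add_sub_mem_gelfandIdeal {f : CCR τ →L[ℂ] ℂ} (hφ : IsState (f : CCR τ →ₗ[ℂ] ℂ))
    {x : G} (hx : f (W τ x) = 1) (hx' : f (W τ (-x)) = 1) (y : G) :
    W τ (y + x) - phase (-τ.form y x) • W τ y ∈ hφ.gelfandIdeal := by
  have e : W τ (y + x) - phase (-τ.form y x) • W τ y =
      (phase (-τ.form y x) • W τ y) * (W τ x - 1) := by
    rw [mul_sub, mul_one, smul_mul_assoc, W_mul_W, smul_smul, ← phase_add, neg_add_cancel,
      phase_zero, one_smul]
  rw [e]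
  exact Ideal.mul_mem_left _ _ (hφ.mem_gelfandIdeal.2 (star_W_sub_one_mul_self f hx hx' hφ.2))

end CCR

/-! ### The form of the topological sector as a difference of gauge phases -/

section TopologicalSector

variable {m k : ℕ} {M : Type*} [TopologicalSpace M] [ChartedSpace (EuclideanSpace ℝ (Fin m)) M]

/-- `(u, ũ, v, ṽ) ↦ ⟨ũ, v⟩ - (-1)^{k(m-k)} ⟨u, ṽ⟩` -/
noncomputable def gaugePhase (hk : 1 ≤ k) (hkm : k + 1 ≤ m) (c : Homology m M (m - 1))
    (x : TopGroup m M k) : UnitAddCircle :=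
  pairing (show m - k - 1 + k = m - 1 by omega) c x.2.1 x.2.2.1
    - (-1 : ℤ) ^ (k * (m - k)) • pairing (show k - 1 + (m - k) = m - 1 by omega) c x.1 x.2.2.2

/-- The form pairs the torus part of each argument with the free part of the other. When the free
parts coincide, the mixed terms become the gauge phases of `x` and of `y`, so `gaugePhase` can serve
as `χ`. -/
theorem tauLR_form (hk : 1 ≤ k) (hkm : k + 1 ≤ m) (c : Homology m M (m - 1))
    (x y : TopGroup m M k) :
    (tauLR hk hkm c).form x y =
      gaugePhase hk hkm c (x.1, x.2.1, y.2.2) - gaugePhase hk hkm c (y.1, y.2.1, x.2.2) := by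
  simp only [tauLR, gaugePhase, AddMonoidHom.mk'_apply]
  abel

theorem gaugePhase_zero_left (hk : 1 ≤ k) (hkm : k + 1 ≤ m) (c : Homology m M (m - 1))
    (v : FreeCohomology m M k × FreeCohomology m M (m - k)) :
    gaugePhase hk hkm c (0, 0, v) = 0 := by
  simp [gaugePhase]

end TopologicalSector

end TopSector

theorem mainTheorem6 (m k : ℕ) (hk : 1 ≤ k) (hkm : k + 1 ≤ m)
    {M : Type*} [TopologicalSpace M] [T2Space M] [ParacompactSpace M]
    [ChartedSpace (EuclideanSpace ℝ (Fin m)) M] [IsManifold (𝓡 m) ∞ M]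
    (g : Spacetime m M)
    {S : Type*} [TopologicalSpace S] [T2Space S] [CompactSpace S]
    [ChartedSpace (EuclideanSpace ℝ (Fin (m - 1))) S] [IsManifold (𝓡 (m - 1)) ∞ S]
    (ι : S → M) (hι : Manifold.IsSmoothEmbedding (𝓡 (m - 1)) (𝓡 m) ∞ ι)
    (hS : g.IsCauchySurface (Set.range ι)) (μ : FundamentalClass (m - 1) S) :
    let c : Homology m M (m - 1) := pushHomology ι hι.contMDiff (m - 1) μ.cls
    let τ : PreSymplectic (TopGroup m M k) := tauLR hk hkm c
    let spec : (CCR τ →L[ℂ] ℂ) → Prop := fun f =>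
      (∀ u u', f (CCR.W τ (u, u', 0, 0)) = 1) ∧
        ∀ u u' v v', (v ≠ 0 ∨ v' ≠ 0) → f (CCR.W τ (u, u', v, v')) = 0
    (∃! f : CCR τ →L[ℂ] ℂ, spec f) ∧
      ∀ f : CCR τ →L[ℂ] ℂ, spec f →
        IsState (f : CCR τ →ₗ[ℂ] ℂ) ∧
        ((∃ (u : TorusCohomology m M (k - 1)) (u' : TorusCohomology m M (m - k - 1)),
            u ≠ 0 ∨ u' ≠ 0) → ¬ IsFaithful (f : CCR τ →ₗ[ℂ] ℂ)) ∧
        ∃ J : Ideal (CCR τ), (∀ a, a ∈ J ↔ f (star a * a) = 0) ∧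
          ∀ u u' v v', CCR.W τ (u, u', v, v') -
            phase (pairing (show m - k - 1 + k = m - 1 by omega) c u' v
              - (-1 : ℤ) ^ (k * (m - k)) •
                  pairing (show k - 1 + (m - k) = m - 1 by omega) c u v') •
              CCR.W τ (0, 0, v, v') ∈ J := by
  intro c τ spec
  let π : TopGroup m M k →+ FreeCohomology m M k × FreeCohomology m M (m - k) :=
    (AddMonoidHom.snd _ _).comp (AddMonoidHom.snd _ _)
  have hχ : ∀ x y, π x = π y → τ.form x y = gaugePhase hk hkm c x - gaugePhase hk hkm c y := by
    intro x y e
    have e' : x.2.2 = y.2.2 := e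
    rw [show τ.form x y = _ from tauLR_form hk hkm c x y, ← e']
    congr 2
    rw [e']
  -- Translates the coordinate conditions into membership in `ker π`, where the general results
  -- apply.
  have hspec (f : CCR τ →L[ℂ] ℂ) : spec f ↔
      (∀ x, π x = 0 → f (CCR.W τ x) = 1) ∧ ∀ x, π x ≠ 0 → f (CCR.W τ x) = 0 := by
    constructor
    · rintro ⟨h1, h0⟩
      refine ⟨?_, ?_⟩
      · rintro ⟨u, u', v⟩ (rfl : v = 0)
        exact h1 u u'
      · rintro ⟨u, u', v, v'⟩ (hv : (v, v') ≠ 0)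
        refine h0 u u' v v' (not_and_or.1 fun h => hv (Prod.ext h.1 h.2))
    · rintro ⟨h1, h0⟩
      refine ⟨fun u u' => h1 _ rfl, fun u u' v v' hv => h0 _ fun h => ?_⟩
      have h' : (v, v') = 0 := h
      exact hv.elim (fun hv => hv (congrArg Prod.fst h')) fun hv => hv (congrArg Prod.snd h')
  refine ⟨(existsUnique_congr hspec).2
    (CCR.existsUnique_kerState (τ := τ) π (gaugePhase hk hkm c) hχ), fun f hf => ?_⟩
  have hφ := CCR.isState_kerState π (gaugePhase hk hkm c) hχ f ((hspec f).1 hf)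
  refine ⟨hφ, ?_, hφ.gelfandIdeal, fun a => hφ.mem_gelfandIdeal, fun u u' v v' => ?_⟩
  · rintro ⟨u, u', hu⟩
    -- A nonzero torus class, padded by zero free part, is a nonzero element of `ker π`.
    refine CCR.not_isFaithful_kerState π f ((hspec f).1 hf).1 (x := (u, u', 0)) rfl fun h => ?_
    exact hu.elim (fun hu => hu (congrArg Prod.fst h))
      fun hu => hu (congrArg (fun x => x.2.1) h)
  · have hker := ((hspec f).1 hf).1
    -- Split the group element into its free part `y` and its torus part `x`. Then `τ(y, x)` is
    -- minus the gauge phase of `y + x`, which gives the stated sign in the exponent.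
    have h := CCR.W_add_sub_mem_gelfandIdeal hφ (x := (u, u', 0)) (hker _ rfl)
      (hker _ (by rw [map_neg, neg_eq_zero]; rfl)) (0, 0, v, v')
    have e : ((0, 0, v, v') : TopGroup m M k) + (u, u', 0) = (u, u', v, v') :=
      Prod.ext (zero_add u) (Prod.ext (zero_add u') (add_zero (v, v')))
    rw [show τ.form (0, 0, v, v') (u, u', 0) = _ from tauLR_form hk hkm c _ _,
      gaugePhase_zero_left, zero_sub, neg_neg, e] at h
    exact h
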